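/- Let $G$ be a finite connected graph with vertex set $V(G)\neq\emptyset$ and edge set $E(G)$, where self-edges and parallel edges are allowed, and let each edge $e$ carry a weight $w(e)>0$. For a vertex $v$ let $d(v)$ be the sum of the weights of all edges incident to $v$ (a self-edge being counted once). A spanning tree of $G$ is a set $t\subseteq E(G)$ such that the graph with vertex set $V(G)$ and edge set $t$ is connected and has no cycles (self-edges and pairs of parallel edges are cycles); its weight is $w(t)=\prod_{e\in t}w(e)$. Let $x\in V(G)$. A weighted random walk on $G$ from $x$ consists of random vertices $X_0,X_1,X_2,\dots$ and random edges $Y_0,Y_1,Y_2,\dots$ ($Y_k$ being the edge travelled from $X_k$ to $X_{k+1}$) on a probability space, such that for all $n\ge 0$, all vertices $v_0,\dots,v_n$ and all edges $e_0,\dots,e_{n-1}$ $$\mathbf P\bigl(X_i=v_i\ (0\le i\le n),\ Y_i=e_i\ (0\le i<n)\bigr)=\prod_{i=0}^{n-1}\frac{w(e_i)}{d(v_i)}$$ if $v_0=x$ and $e_i$ connects $v_i$ to $v_{i+1}$ for every $i<n$, and the probability is $0$ otherwise. The groundskeeper's algorithm (Aldous–Broder) keeps, for each newly visited vertex, the edge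 by which it was first entered, oriented from the new vertex back to the old one. Let $\mathbf T$ be the random set of edges obtained by ignoring the orientations, i.e. $\mathbf T=\{Y_k : k\ge 0,\ X_{k+1}\notin\{X_0,\dots,X_k\}\}$. Then $\mathbf T$ is almost surely a spanning tree of $G$, and it has the weight-selected distribution: for every spanning tree $t$ of $G$, $$\mathbf P(\mathbf T=t)=\frac{\prod_{e\in t}w(e)}{\sum_{u}\prod_{e\in u}w(e)},$$ where $u$ ranges over all spanning trees of $G$. In particular, if all weights are equal to $1$ (so that the walk is simple random walk), then $\mathbf T$ is uniformly distributed over the spanning trees of $G$. -/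

import Mathlib

open scoped Graph
open MeasureTheory

noncomputable section

namespace Graph

variable {α β : Type*}

/-- `G` is connected: it has a vertex, and any two vertices are joined by a path of edges. -/
def Connected (G : Graph α β) : Prop :=
  V(G).Nonempty ∧ ∀ u ∈ V(G), ∀ v ∈ V(G), Relation.ReflTransGen G.Adj u v

/-- `G` has no cycles. A cycle consists of `n + 1 ≥ 1` distinct vertices `v 0, …, v n` and
distinct edges `e 0, …, e n`, where `e i` connects `v i` to `v (i + 1)`, indices being taken
modulo `n + 1` (the addition of `Fin (n + 1)`). Self-edges (`n = 0`) and pairs of parallel edges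
(`n = 1`) are cycles. -/
def Acyclic (G : Graph α β) : Prop :=
  ¬ ∃ (n : ℕ) (v : Fin (n + 1) → α) (e : Fin (n + 1) → β),
    Function.Injective v ∧ Function.Injective e ∧ ∀ i, G.IsLink (e i) (v i) (v (i + 1))

/-- A set `t` of edges of `G` is (the edge set of) a spanning tree: the subgraph of `G` with all
the vertices of `G` and with edge set `t` is connected and has no cycles. -/
def IsSpanningTree (G : Graph α β) (t : Set β) : Prop :=
  t ⊆ E(G) ∧ (G.restrict t).Connected ∧ (G.restrict t).Acyclic

/-- The sum `d(v)` of the weights of all edges incident to `v` (a self-edge counts once). -/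
def weightedDegree (G : Graph α β) (w : β → ℝ) (v : α) : ℝ :=
  ∑ᶠ e ∈ G.incidenceSet v, w e

open Classical in
/-- The probability that the weighted random walk, when at `v`, walks along `e` and so gets to
`u`: it is `w e / d(v)` if `e` connects `v` to `u`, and `0` otherwise. -/
def stepProb (G : Graph α β) (w : β → ℝ) (v : α) (e : β) (u : α) : ℝ :=
  if G.IsLink e v u then w e / G.weightedDegree w v else 0

open Classical in
/-- `(X, Y)` is a weighted random walk on `G` from `x`, where `X n` is the position at time `n`
and `Y n` is the edge travelled between times `n` and `n + 1`; it is defined through its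
finite-dimensional marginals. -/
structure IsWeightedRandomWalk (G : Graph α β) (w : β → ℝ) (x : V(G))
    {Ω : Type*} [MeasurableSpace Ω] (P : Measure Ω)
    (X : ℕ → Ω → V(G)) (Y : ℕ → Ω → E(G)) : Prop where
  measurableSet_position : ∀ n v, MeasurableSet {ω | X n ω = v}
  measurableSet_edge : ∀ n e, MeasurableSet {ω | Y n ω = e}
  marginal : ∀ (n : ℕ) (v : ℕ → V(G)) (e : ℕ → E(G)),
    P {ω | (∀ i ≤ n, X i ω = v i) ∧ ∀ i < n, Y i ω = e i} =
      if v 0 = x then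
        ∏ i ∈ Finset.range n, ENNReal.ofReal (G.stepProb w (v i) (e i) (v (i + 1)))
      else 0

/-- The weight of a spanning tree: the product of the weights of its edges. -/
def treeWeight (w : β → ℝ) (t : Set β) : ℝ := ∏ᶠ e ∈ t, w e

/-- The probability of the spanning tree `t` under the weight-selected distribution. -/
def weightSelectedProb (G : Graph α β) (w : β → ℝ) (t : Set β) : ℝ :=
  treeWeight w t / ∑ᶠ u ∈ {u : Set β | G.IsSpanningTree u}, treeWeight w u

/-- The groundskeeper's algorithm applied to the walk that visits `y 0, y 1, …` and travels along
`f k` from `y k` to `y (k + 1)`. The output is the set of chalked arrows, an arrow `(e, z, v)`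
being an edge `e` oriented from the new vertex `z` back to the old one `v`: the edge `f k` is
chalked exactly if `y (k + 1)` is then visited for the first time. -/
def groundskeeper (y : ℕ → α) (f : ℕ → β) : Set (β × α × α) :=
  {a | ∃ k, a = (f k, y (k + 1), y k) ∧ ∀ j ≤ k, y j ≠ y (k + 1)}

/-- The edges chalked by the groundskeeper, the arrows being ignored. -/
def groundskeeperTree (y : ℕ → α) (f : ℕ → β) : Set β :=
  Prod.fst '' groundskeeper y f

end Graph

end

/-!
Place at the position `X n` a random arborescence rooted there, with probability proportional to
its weight, and prepend the walk `X 0, …, X n` to it: every vertex that this walk enters gets the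
arrow back along the edge of its first entrance. The distribution of the resulting arborescence
with root `X 0` does not depend on `n`. Indeed, with an extra arrow at the root, chosen with
probability proportional to its weight, the arrows contain exactly one cycle, and it passes through
the root; moving the root one step along this cycle corresponds to reversing a step of the walk.
At `n = 0` the arborescence is weight-selected, and once the walk has visited all vertices it is
the output of the groundskeeper's algorithm.
-/

noncomputable section

namespace AldousBroder

open Function Graph
open scoped ENNReal

section Rooted

variable {V : Type*} {p : V → V} {r : V}

/-- The map `p` is rooted at `r` if iterating it leads from every point to `r`. It encodes a tree
with root `r`, `p v` being the parent of `v`; the value `p r` is irrelevant. -/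
def IsRootedAt (p : V → V) (r : V) : Prop :=
  ∀ v, ∃ n, p^[n] v = r

lemma isRootedAt_iff_exists_rank :
    IsRootedAt p r ↔ ∃ k : V → ℕ, ∀ v, v ≠ r → k (p v) < k v := by
  classical
  refine ⟨fun h => ⟨fun v => Nat.find (h v), fun v hv => ?_⟩, fun ⟨k, hk⟩ v => ?_⟩
  · have hpos : Nat.find (h v) ≠ 0 := fun h₀ => hv ((Nat.find_eq_zero (h v)).1 h₀)
    obtain ⟨n, hn⟩ := Nat.exists_eq_succ_of_ne_zero hpos
    have hspec := Nat.find_spec (h v)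
    rw [hn, iterate_succ_apply] at hspec
    change Nat.find (h (p v)) < Nat.find (h v)
    rw [hn]
    exact Nat.lt_succ_of_le (Nat.find_min' _ hspec)
  · induction hm : k v using Nat.strong_induction_on generalizing v with
    | _ m ih =>
      by_cases hv : v = r
      · exact ⟨0, hv⟩
      · obtain ⟨n, hn⟩ := ih _ (hm ▸ hk v hv) (p v) rfl
        exact ⟨n + 1, hn⟩

lemma isRootedAt_update_iff [DecidableEq V] {u : V} :
    IsRootedAt (update p r u) r ↔ IsRootedAt p r := by
  simp only [isRootedAt_iff_exists_rank]
  exact exists_congr fun k => forall₂_congr fun v hv => by rw [update_of_ne hv]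

lemma IsRootedAt.exists_path (h : IsRootedAt p r) (u : V) :
    ∃ n, p^[n] u = r ∧ (∀ i < n, p^[i] u ≠ r) ∧ Set.InjOn (fun i => p^[i] u) (Set.Iic n) := by
  classical
  set n := Nat.find (h u)
  have hn : p^[n] u = r := Nat.find_spec (h u)
  have hmin : ∀ i < n, p^[i] u ≠ r := fun i hi => Nat.find_min (h u) hi
  refine ⟨n, hn, hmin, ?_⟩
  have hlt : ∀ i j, i < j → j ≤ n → p^[i] u ≠ p^[j] u := by
    intro i j hij hj heq
    refine hmin (n - j + i) (by omega) ?_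
    rw [iterate_add_apply, heq, ← iterate_add_apply, Nat.sub_add_cancel hj, hn]
  intro i hi j hj hij
  rcases lt_trichotomy i j with h' | h' | h'
  · exact absurd hij (hlt i j h' hj)
  · exact h'
  · exact absurd hij.symm (hlt j i h' hi)

lemma IsRootedAt.apply (h : IsRootedAt p r) : IsRootedAt p (p r) := fun v =>
  (h v).elim fun n hn => ⟨n + 1, by rw [iterate_succ_apply', hn]⟩

/-- If `p` is rooted at `y` then its orbits all end up in one cycle through `y`, and the points at
which `p` is rooted are those of the cycle. -/
lemma IsRootedAt.existsUnique_preimage {y : V} (h : IsRootedAt p y) :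
    ∃! z, IsRootedAt p z ∧ p z = y := by
  obtain ⟨n, hn⟩ := h (p y)
  have hy : y ∈ periodicPts p := mk_mem_periodicPts (n := n + 1) n.succ_pos hn
  have hper : ∀ z, IsRootedAt p z → z ∈ periodicPts p := by
    intro z hz
    obtain ⟨m, rfl⟩ := hz y
    exact (bijOn_periodicPts p).mapsTo.iterate m hy
  have hz₀ : IsRootedAt p (p^[n] y) := fun v =>
    (h v).elim fun m hm => ⟨n + m, by rw [iterate_add_apply, hm]⟩
  have hpz₀ : p (p^[n] y) = y := by rw [← iterate_succ_apply' p, iterate_succ_apply, hn]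
  exact ⟨p^[n] y, ⟨hz₀, hpz₀⟩, fun z ⟨hz, hpz⟩ =>
    (bijOn_periodicPts p).injOn (hper z hz) (hper _ hz₀) (hpz.trans hpz₀.symm)⟩

lemma exists_isRootedAt_of_reflTransGen {ρ : V → V → Prop}
    (h : ∀ v, Relation.ReflTransGen ρ v r) : ∃ p, IsRootedAt p r ∧ ∀ v, v ≠ r → ρ v (p v) := by
  classical
  let pred : Set V → Set V := fun s => {v | ∃ z ∈ s, ρ v z}
  have hreach : ∀ v, ∃ n, v ∈ pred^[n] {r} := by
    intro v
    induction h v using Relation.ReflTransGen.head_induction_on with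
    | refl => exact ⟨0, rfl⟩
    | head hvz _ ih =>
      obtain ⟨n, hn⟩ := ih
      exact ⟨n + 1, by rw [iterate_succ_apply']; exact ⟨_, hn, hvz⟩⟩
  have hparent : ∀ v, ∃ z, v ≠ r → ρ v z ∧ Nat.find (hreach z) < Nat.find (hreach v) := by
    intro v
    have hv := Nat.find_spec (hreach v)
    rcases hn : Nat.find (hreach v) with _ | n
    · rw [hn] at hv
      exact ⟨v, fun hvr => absurd hv hvr⟩
    · rw [hn, iterate_succ_apply'] at hv
      obtain ⟨z, hz, hvz⟩ := hv
      exact ⟨z, fun _ => ⟨hvz, Nat.lt_succ_of_le (Nat.find_min' _ hz)⟩⟩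
  choose p hp using hparent
  exact ⟨p, isRootedAt_iff_exists_rank.2 ⟨fun v => Nat.find (hreach v), fun v hv => (hp v hv).2⟩,
    fun v hv => (hp v hv).1⟩

end Rooted

section RootedSum

variable {V E : Type*} [DecidableEq V] [Fintype V]

lemma prod_update_mul {S M : Type*} [CommMonoid M] (c : V → S → M) (a : V → S) (z : V) (s : S) :
    (∏ v, c v (update a z s v)) * c z (a z) = (∏ v, c v (a v)) * c z s := by
  rw [← Finset.mul_prod_erase _ _ (Finset.mem_univ z),
    ← Finset.mul_prod_erase _ (fun v => c v (a v)) (Finset.mem_univ z), update_self,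
    Finset.prod_congr rfl fun v hv => by rw [update_of_ne (Finset.ne_of_mem_erase hv)],
    mul_right_comm, mul_comm (c z s), mul_right_comm]

variable [Fintype E] (c : V → E × V → ℝ≥0∞)

open Classical in
/-- An arrow at a vertex is a pair `(e, u)` of an edge and a head. `rootedSum c r φ` is the sum of
`φ` over all systems `a` of arrows, one at each vertex, whose heads lead to the root `r`, weighted
by the product of the weights `c` of the arrows. The arrow at `r` is free, and its weight is part
of the product. -/
def rootedSum (r : V) (φ : (V → E × V) → ℝ≥0∞) : ℝ≥0∞ :=
  ∑ a, if IsRootedAt (Prod.snd ∘ a) r then (∏ v, c v (a v)) * φ a else 0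

variable {c} in
lemma rootedSum_mono {r : V} {φ ψ : (V → E × V) → ℝ≥0∞} (h : ∀ a, φ a ≤ ψ a) :
    rootedSum c r φ ≤ rootedSum c r ψ := by
  refine Finset.sum_le_sum fun a _ => ?_
  split_ifs
  · gcongr
    exact h a
  · exact le_rfl

lemma sum_mul_rootedSum (z : V) (φ : (V → E × V) → ℝ≥0∞) :
    (∑ s, c z s) * rootedSum c z φ =
      ∑ s, c z s * rootedSum c z (fun a => φ (update a z s)) := by
  classical
  -- The involution exchanging the arrow `s` with the arrow of `a` at `z` matches the two sides.
  have hswap : Involutive fun q : (E × V) × (V → E × V) => (q.2 z, update q.2 z q.1) :=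
    fun q => by simp
  simp only [rootedSum, Finset.sum_mul, Finset.mul_sum]
  rw [Finset.sum_comm, ← Fintype.sum_prod_type', ← Fintype.sum_prod_type']
  refine Fintype.sum_equiv hswap.toPerm _ _ fun ⟨s, a⟩ => ?_
  change _ = c z (a z) * if IsRootedAt (Prod.snd ∘ update a z s) z then
    (∏ v, c v (update a z s v)) * φ (update (update a z s) z (a z)) else 0
  rw [comp_update, isRootedAt_update_iff, update_idem, update_eq_self]
  split_ifs
  · rw [← mul_assoc, ← mul_assoc, mul_comm (c z (a z)), prod_update_mul, mul_comm (c z s)]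
  · simp only [mul_zero]

lemma sum_mul_rootedSum_ite_head (z y : V) (φ : (V → E × V) → ℝ≥0∞) :
    (∑ s, c z s) * rootedSum c z (fun a => if (a z).2 = y then φ a else 0) =
      ∑ e, c z (e, y) * rootedSum c z (fun a => φ (update a z (e, y))) := by
  rw [sum_mul_rootedSum, Fintype.sum_prod_type]
  refine Finset.sum_congr rfl fun e _ => ?_
  rw [Finset.sum_eq_single y (fun u _ hu => by simp [hu, rootedSum]) (by simp)]
  simp

lemma sum_rootedSum_ite_head (y : V) (φ : (V → E × V) → ℝ≥0∞) :
    ∑ z, rootedSum c z (fun a => if (a z).2 = y then φ a else 0) = rootedSum c y φ := by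
  simp only [rootedSum]
  rw [Finset.sum_comm]
  refine Finset.sum_congr rfl fun a _ => ?_
  split_ifs with hy
  · obtain ⟨z, ⟨hz, hzy⟩, hunique⟩ := hy.existsUnique_preimage
    replace hzy : (a z).2 = y := hzy
    rw [Finset.sum_eq_single z _ (by simp), if_pos hz, if_pos hzy]
    intro u _ hu
    by_cases hroot : IsRootedAt (Prod.snd ∘ a) u
    · rw [if_neg fun huy : (a u).2 = y => hu (hunique u ⟨hroot, huy⟩), mul_zero, ite_self]
    · rw [if_neg hroot]
  · refine Finset.sum_eq_zero fun z _ => ?_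
    by_cases hz : IsRootedAt (Prod.snd ∘ a) z
    · rw [if_neg fun hzy : (a z).2 = y => hy (hzy ▸ hz.apply), mul_zero, ite_self]
    · rw [if_neg hz]

/-- Reversing the last step of a walk from `y` to `s.2` moves the root of a random system of arrows
from `s.2` back to `y`. -/
lemma sum_mul_rootedSum_update_div (h₀ : ∀ z, ∑ s, c z s ≠ 0) (h_top : ∀ z, ∑ s, c z s ≠ ⊤)
    (y : V) (φ : (V → E × V) → ℝ≥0∞) :
    ∑ s : E × V, c s.2 (s.1, y) *
      (rootedSum c s.2 (fun a => φ (update a s.2 (s.1, y))) / ∑ s', c s.2 s') =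
      rootedSum c y φ := by
  rw [← sum_rootedSum_ite_head, Fintype.sum_prod_type_right]
  refine Finset.sum_congr rfl fun z _ => ?_
  simp only [div_eq_mul_inv, ← mul_assoc, ← Finset.sum_mul]
  rw [← sum_mul_rootedSum_ite_head, mul_right_comm, ENNReal.mul_inv_cancel (h₀ z) (h_top z),
    one_mul]

end RootedSum

section Arborescence

variable {α β : Type*} {G : Graph α β}

lemma reflTransGen_adj_of_connected (hG : G.Connected) (u v : V(G)) :
    Relation.ReflTransGen (fun y z : V(G) => G.Adj y z) u v := by
  suffices h : ∀ z, Relation.ReflTransGen G.Adj u z → ∀ hz : z ∈ V(G),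
      Relation.ReflTransGen (fun y z : V(G) => G.Adj y z) u ⟨z, hz⟩ from h v (hG.2 u u.2 v v.2) v.2
  intro z huz
  induction huz with
  | refl => exact fun _ => .refl
  | tail _ hadj ih => exact fun _ => (ih hadj.left_mem).tail hadj

lemma not_acyclic_of_path {n : ℕ} {y : ℕ → α} {g : ℕ → β} {f : β}
    (hy : Set.InjOn y (Set.Iic n)) (hg : ∀ i < n, G.IsLink (g i) (y i) (y (i + 1)))
    (hf : G.IsLink f (y n) (y 0)) (hgf : ∀ i < n, g i ≠ f) : ¬ G.Acyclic := by
  have hstep : ∀ i < n, ∀ j < n, g i = g j → i = j ∨ i = j + 1 := by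
    intro i hi j hj hij
    exact ((hg i hi).left_eq_or_eq (hij ▸ hg j hj)).imp
      (hy hi.le hj.le) (hy hi.le (Nat.succ_le_of_lt hj))
  have hginj : Injective fun i : Fin n => g i := fun i j hij => by
    have := hstep i i.2 j j.2 hij
    have := hstep j j.2 i i.2 hij.symm
    omega
  refine not_not_intro ⟨n, fun i => y i, Fin.snoc (fun i => g i) f, ?_, ?_, ?_⟩
  · exact fun i j hij => Fin.ext (hy (Nat.lt_succ_iff.1 i.2) (Nat.lt_succ_iff.1 j.2) hij)
  · rw [Fin.snoc_injective_iff]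
    exact ⟨hginj, fun ⟨i, hi⟩ => hgf i i.2 hi⟩
  · refine Fin.lastCases ?_ fun i => ?_
    · simpa only [Fin.snoc_last, Fin.val_last, Fin.last_add_one, Fin.val_zero] using hf
    · simpa only [Fin.snoc_castSucc, Fin.val_castSucc, Fin.coeSucc_eq_succ, Fin.val_succ]
        using hg i i.2

/-- The edges of the arrows of the system `a` at the vertices other than the root `r`. -/
def arrowEdges {V E : Type*} (a : V → E × V) (r : V) : Set E :=
  (fun v => (a v).1) '' {r}ᶜ

variable {a b : V(G) → E(G) × V(G)} {r : V(G)}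

variable (G) in
/-- The arrows of `a` at the vertices other than `r` run along edges of `G` and lead to the
root `r`. Nothing is required of the arrow at `r`. -/
structure IsArborescence (a : V(G) → E(G) × V(G)) (r : V(G)) : Prop where
  isLink : ∀ v, v ≠ r → G.IsLink (a v).1 v (a v).2
  isRootedAt : IsRootedAt (Prod.snd ∘ a) r

namespace IsArborescence

lemma eq_of_isLink_of_rank_le (h : IsArborescence G a r) {k : V(G) → ℕ}
    (hk : ∀ v, v ≠ r → k (a v).2 < k v) {f : E(G)} (hf : f ∈ arrowEdges a r) {u v : V(G)}
    (hl : G.IsLink f u v) (hvu : k v ≤ k u) : u ≠ r ∧ a u = (f, v) := by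
  obtain ⟨z, hz, rfl⟩ := hf
  rcases (h.isLink z hz).eq_and_eq_or_eq_and_eq hl with ⟨hzu, hzv⟩ | ⟨hzv, hzu⟩
  · obtain rfl := Subtype.ext hzu
    exact ⟨hz, Prod.ext rfl (Subtype.ext hzv)⟩
  · obtain rfl := Subtype.ext hzv
    have hlt := hk z hz
    rw [Subtype.ext hzu] at hlt
    exact absurd hvu hlt.not_ge

lemma injOn (h : IsArborescence G a r) : Set.InjOn (fun v => (a v).1) {r}ᶜ := by
  obtain ⟨k, hk⟩ := isRootedAt_iff_exists_rank.1 h.isRootedAt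
  have hkey : ∀ u ≠ r, ∀ v ≠ r, (a u).1 = (a v).1 → k u ≤ k v → u = v := by
    intro u hu v hv huv hle
    have hl := h.isLink u hu
    rw [huv] at hl
    rcases hl.eq_and_eq_or_eq_and_eq (h.isLink v hv) with ⟨heq, -⟩ | ⟨-, heq⟩
    · exact Subtype.ext heq
    · have hlt := hk u hu
      rw [comp_apply, Subtype.ext heq] at hlt
      exact absurd hle hlt.not_ge
  intro u hu v hv huv
  rcases le_total (k u) (k v) with hle | hle
  · exact hkey u hu v hv huv hle
  · exact (hkey v hv u hu huv.symm hle).symm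

lemma connected_restrict (h : IsArborescence G a r) :
    (G.restrict (Subtype.val '' arrowEdges a r)).Connected := by
  set H := G.restrict (Subtype.val '' arrowEdges a r)
  have hadj : ∀ v, v ≠ r → H.Adj v (a v).2 := fun v hv =>
    ⟨(a v).1, ⟨_, ⟨v, hv, rfl⟩, rfl⟩, h.isLink v hv⟩
  have hreach : ∀ n, ∀ v : V(G), (Prod.snd ∘ a)^[n] v = r → Relation.ReflTransGen H.Adj v r := by
    intro n
    induction n with
    | zero => rintro v rfl; exact .refl
    | succ n ih =>
      intro v hv
      rcases eq_or_ne v r with rfl | hvr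
      · exact .refl
      · exact .head (hadj v hvr) (ih _ hv)
  have hroot : ∀ v : V(G), Relation.ReflTransGen H.Adj v r := fun v =>
    (h.isRootedAt v).elim fun n hn => hreach n v hn
  exact ⟨⟨r, r.2⟩, fun u hu v hv => (hroot ⟨u, hu⟩).trans (Std.Symm.symm _ _ (hroot ⟨v, hv⟩))⟩

lemma acyclic_restrict (h : IsArborescence G a r) :
    (G.restrict (Subtype.val '' arrowEdges a r)).Acyclic := by
  obtain ⟨k, hk⟩ := isRootedAt_iff_exists_rank.1 h.isRootedAt
  rintro ⟨n, v, e, -, he, hl⟩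
  lift v to Fin (n + 1) → V(G) using fun i => (hl i).left_mem
  choose f hf hfe using fun i => (hl i).1
  obtain rfl : (fun i => (f i : β)) = e := funext hfe
  -- At a vertex of maximal rank both edges of the cycle would have to be the arrow of `a`.
  obtain ⟨i, hi⟩ := Finite.exists_max fun i => k (v i)
  have hnext := h.eq_of_isLink_of_rank_le hk (hf i) (hl i).2 (hi _)
  have hlink : G.IsLink (f (i - 1)) (v i) (v (i - 1)) := by
    simpa only [sub_add_cancel] using (hl (i - 1)).2.symm
  have hprev := h.eq_of_isLink_of_rank_le hk (hf (i - 1)) hlink (hi _)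
  have hff : f i = f (i - 1) := congrArg Prod.fst (hnext.2.symm.trans hprev.2)
  have hii : i = i - 1 := he (congrArg Subtype.val hff)
  have hlt := hk (v i) hprev.1
  rw [comp_apply, hprev.2, ← hii] at hlt
  exact lt_irrefl _ hlt

lemma isSpanningTree (h : IsArborescence G a r) :
    G.IsSpanningTree (Subtype.val '' arrowEdges a r) :=
  ⟨Subtype.coe_image_subset _ _, h.connected_restrict, h.acyclic_restrict⟩

lemma eq_of_arrowEdges_eq (ha : IsArborescence G a r) (hb : IsArborescence G b r)
    (hab : arrowEdges a r = arrowEdges b r) : ∀ v, v ≠ r → a v = b v := by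
  obtain ⟨k, hk⟩ := isRootedAt_iff_exists_rank.1 hb.isRootedAt
  intro v hv
  induction hm : k v using Nat.strong_induction_on generalizing v with
  | _ m ih =>
    obtain ⟨u, hu, huv⟩ : (b v).1 ∈ arrowEdges a r := hab ▸ ⟨v, hv, rfl⟩
    have hl := ha.isLink u hu
    simp only at huv
    rw [huv] at hl
    rcases hl.eq_and_eq_or_eq_and_eq (hb.isLink v hv) with ⟨hleft, hright⟩ | ⟨hleft, hright⟩
    · obtain rfl := Subtype.ext hleft
      exact Prod.ext huv (Subtype.ext hright)
    · have hdesc := hk v hv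
      rw [comp_apply, ← Subtype.ext hleft] at hdesc
      have hasc := hk u hu
      rw [comp_apply, ← ih _ (hm ▸ hdesc) u hu rfl, Subtype.ext hright] at hasc
      exact absurd hasc hdesc.not_gt

end IsArborescence

lemma exists_isArborescence_of_connected_restrict [Nonempty E(G)] {t : Set β}
    (ht : (G.restrict t).Connected) (r : V(G)) :
    ∃ a, IsArborescence G a r ∧ Subtype.val '' arrowEdges a r ⊆ t := by
  obtain ⟨p, hp, hadj⟩ := exists_isRootedAt_of_reflTransGen
    fun v : V(G) => reflTransGen_adj_of_connected ht v r
  have hedge : ∀ v, ∃ e : E(G), v ≠ r → (e : β) ∈ t ∧ G.IsLink e v (p v) := by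
    intro v
    by_cases hv : v = r
    · exact ⟨Classical.arbitrary _, fun hne => absurd hv hne⟩
    · obtain ⟨e, het, he⟩ := hadj v hv
      exact ⟨⟨e, he.edge_mem⟩, fun _ => ⟨het, he⟩⟩
  choose e he using hedge
  refine ⟨fun v => (e v, p v), ⟨fun v hv => (he v hv).2, hp⟩, ?_⟩
  rintro _ ⟨_, ⟨v, hv, rfl⟩, rfl⟩
  exact (he v hv).1

lemma edgeSet_subset_of_acyclic_of_connected_restrict (hG : G.Acyclic) {s : Set β}
    (hs : (G.restrict s).Connected) : E(G) ⊆ s := by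
  refine fun f hf => by_contra fun hfs => ?_
  have : Nonempty E(G) := ⟨⟨f, hf⟩⟩
  obtain ⟨u, v, hfuv⟩ := exists_isLink_of_mem_edgeSet hf
  lift u to V(G) using hfuv.left_mem
  lift v to V(G) using hfuv.right_mem
  obtain ⟨a, ha, has⟩ := exists_isArborescence_of_connected_restrict hs v
  obtain ⟨n, hn, hmin, hinj⟩ := ha.isRootedAt.exists_path u
  set y : ℕ → V(G) := fun i => (Prod.snd ∘ a)^[i] u
  refine not_acyclic_of_path (n := n) (y := fun i => (y i : α)) (g := fun i => ((a (y i)).1 : β))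
    (f := f) (Subtype.val_injective.comp_injOn hinj) (fun i hi => ?_) ?_ (fun i hi hif => hfs ?_) hG
  · rw [show y (i + 1) = (a (y i)).2 from iterate_succ_apply' _ i u]
    exact ha.isLink _ (hmin i hi)
  · rw [show y n = v from hn]
    exact hfuv.symm
  · exact hif ▸ has ⟨_, ⟨y i, hmin i hi, rfl⟩, rfl⟩

lemma exists_isArborescence_of_isSpanningTree [Nonempty E(G)] {t : Set β}
    (ht : G.IsSpanningTree t) (r : V(G)) :
    ∃ a, IsArborescence G a r ∧ Subtype.val '' arrowEdges a r = t := by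
  obtain ⟨htE, hconn, hacyc⟩ := ht
  obtain ⟨a, ha, hat⟩ := exists_isArborescence_of_connected_restrict hconn r
  refine ⟨a, ha, hat.antisymm ?_⟩
  have hsub := edgeSet_subset_of_acyclic_of_connected_restrict hacyc
    (s := Subtype.val '' arrowEdges a r)
    (by rw [restrict_restrict, Set.inter_eq_right.2 hat]; exact ha.connected_restrict)
  rwa [edgeSet_restrict, Set.inter_eq_right.2 htE] at hsub

end Arborescence

section Weights

variable {α β : Type*} {G : Graph α β} {w : β → ℝ}

section Degree

variable [Finite E(G)]

lemma weightedDegree_pos (hw : ∀ e ∈ E(G), 0 < w e) {e : β} {v u : α} (h : G.IsLink e v u) :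
    0 < G.weightedDegree w v := by
  have hfin : (G.incidenceSet v).Finite :=
    Set.Finite.subset (Set.toFinite E(G)) fun f hf => hf.edge_mem
  rw [weightedDegree, finsum_mem_eq_finite_toFinset_sum _ hfin]
  exact Finset.sum_pos (fun f hf => hw f (hfin.mem_toFinset.1 hf).edge_mem)
    ⟨e, hfin.mem_toFinset.2 h.inc_left⟩

lemma stepProb_pos (hw : ∀ e ∈ E(G), 0 < w e) {e : β} {v u : α} (h : G.IsLink e v u) :
    0 < G.stepProb w v e u := by
  rw [stepProb, if_pos h]
  exact div_pos (hw e h.edge_mem) (weightedDegree_pos hw h)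

lemma weightedDegree_pos_of_connected [Nonempty E(G)] (hG : G.Connected)
    (hw : ∀ e ∈ E(G), 0 < w e) {v : α} (hv : v ∈ V(G)) : 0 < G.weightedDegree w v := by
  obtain ⟨e, he⟩ := Classical.arbitrary E(G)
  obtain ⟨a, b, hab⟩ := exists_isLink_of_mem_edgeSet he
  rcases (hG.2 v hv a hab.left_mem).cases_head with rfl | ⟨u, ⟨f, hf⟩, -⟩
  · exact weightedDegree_pos hw hab
  · exact weightedDegree_pos hw hf

end Degree

variable (G w) in
open Classical in
/-- The weight of the arrow `s` placed at `v`: the weight of its edge if this edge connects `v` to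
the head of the arrow, and `0` otherwise. -/
def arrowWeight (v : V(G)) (s : E(G) × V(G)) : ℝ≥0∞ :=
  if G.IsLink s.1 v s.2 then ENNReal.ofReal (w s.1) else 0

lemma arrowWeight_comm (u v : V(G)) (e : E(G)) :
    arrowWeight G w u (e, v) = arrowWeight G w v (e, u) := by
  classical
  exact if_congr G.isLink_comm rfl rfl

lemma ofReal_stepProb [Finite E(G)] (hw : ∀ e ∈ E(G), 0 < w e) (v : V(G)) (s : E(G) × V(G)) :
    ENNReal.ofReal (G.stepProb w v s.1 s.2) =
      arrowWeight G w v s / ENNReal.ofReal (G.weightedDegree w v) := by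
  rw [stepProb, arrowWeight]
  split_ifs with h
  · exact ENNReal.ofReal_div_of_pos (weightedDegree_pos hw h)
  · rw [ENNReal.ofReal_zero, ENNReal.zero_div]

lemma sum_arrowWeight [Fintype V(G)] [Fintype E(G)] (hw : ∀ e ∈ E(G), 0 < w e) (v : V(G)) :
    ∑ s, arrowWeight G w v s = ENNReal.ofReal (G.weightedDegree w v) := by
  classical
  have hinc : G.incidenceSet v =
      Subtype.val '' (Finset.univ.filter fun e : E(G) => G.Inc e v : Set E(G)) := by
    ext f
    simpa using Inc.edge_mem
  rw [weightedDegree, hinc, finsum_mem_image Subtype.val_injective.injOn, finsum_mem_coe_finset,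
    ENNReal.ofReal_sum_of_nonneg fun (e : E(G)) _ => (hw e e.2).le, Finset.sum_filter,
    Fintype.sum_prod_type]
  refine Finset.sum_congr rfl fun e _ => ?_
  simp only [arrowWeight]
  split_ifs with h
  · obtain ⟨u, hu⟩ := h
    rw [Finset.sum_eq_single ⟨u, hu.right_mem⟩ _ (by simp), if_pos hu]
    exact fun z _ hz => if_neg fun hz' => hz (Subtype.ext (hz'.right_unique hu))
  · exact Finset.sum_eq_zero fun u _ => if_neg fun hu => h ⟨u, hu⟩

lemma treeWeight_pos [Finite E(G)] (hw : ∀ e ∈ E(G), 0 < w e) {t : Set β} (ht : t ⊆ E(G)) :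
    0 < treeWeight w t := by
  rw [treeWeight, finprod_mem_eq_finite_toFinset_prod _ ((Set.toFinite E(G)).subset ht)]
  exact Finset.prod_pos fun e he => hw e (ht ((Set.Finite.mem_toFinset _).1 he))

lemma finite_setOf_isSpanningTree [Finite E(G)] : {t | G.IsSpanningTree t}.Finite :=
  (Set.toFinite E(G)).finite_subsets.subset fun _ ht => ht.1

variable (G) in
/-- The spanning trees of `G`, as a finite set of sets of edges. -/
def spanningTrees [Finite E(G)] : Finset (Set β) :=
  (finite_setOf_isSpanningTree (G := G)).toFinset

lemma mem_spanningTrees [Finite E(G)] {t : Set β} : t ∈ spanningTrees G ↔ G.IsSpanningTree t :=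
  Set.Finite.mem_toFinset _

lemma weightSelectedProb_eq_div [Finite E(G)] (t : Set β) :
    G.weightSelectedProb w t = treeWeight w t / ∑ u ∈ spanningTrees G, treeWeight w u := by
  rw [weightSelectedProb, finsum_mem_eq_finite_toFinset_sum, spanningTrees]

lemma ofReal_weightSelectedProb_of_eq_one [Finite E(G)] (hw : ∀ e ∈ E(G), w e = 1) {t : Set β}
    (ht : G.IsSpanningTree t) :
    ENNReal.ofReal (G.weightSelectedProb w t) =
      1 / ({u : Set β | G.IsSpanningTree u}.ncard : ℝ≥0∞) := by
  have hone : ∀ u ∈ spanningTrees G, treeWeight w u = 1 := fun u hu =>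
    finprod_mem_of_eqOn_one fun e he => hw e ((mem_spanningTrees.1 hu).1 he)
  have htrees := mem_spanningTrees.2 ht
  have hcard : 0 < (spanningTrees G).card := Finset.card_pos.2 ⟨t, htrees⟩
  rw [weightSelectedProb_eq_div, hone t htrees, Finset.sum_congr rfl hone, Finset.sum_const,
    nsmul_one, ENNReal.ofReal_div_of_pos (Nat.cast_pos.2 hcard), ENNReal.ofReal_one,
    ENNReal.ofReal_natCast, spanningTrees,
    ← Set.ncard_eq_toFinset_card _ finite_setOf_isSpanningTree]

section ArborescenceSum

variable {a : V(G) → E(G) × V(G)} {r : V(G)}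

lemma IsArborescence.prod_arrowWeight [Fintype V(G)] (h : IsArborescence G a r)
    (hw : ∀ e ∈ E(G), 0 < w e) :
    ∏ v, arrowWeight G w v (a v) =
      arrowWeight G w r (a r) * ENNReal.ofReal (treeWeight w (Subtype.val '' arrowEdges a r)) := by
  classical
  have hinj : Set.InjOn (fun v => ((a v).1 : β)) {r}ᶜ := Subtype.val_injective.comp_injOn h.injOn
  have hcoe : ({r}ᶜ : Set V(G)) = (Finset.univ.erase r : Finset V(G)) := by
    ext v
    simp
  rw [treeWeight, arrowEdges, Set.image_image, finprod_mem_image hinj, hcoe, finprod_mem_coe_finset,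
    ENNReal.ofReal_prod_of_nonneg fun v _ => (hw _ (a v).1.2).le,
    ← Finset.mul_prod_erase _ _ (Finset.mem_univ r)]
  congr 1
  exact Finset.prod_congr rfl fun v hv => if_pos (h.isLink v (Finset.ne_of_mem_erase hv))

lemma isArborescence_of_prod_arrowWeight_ne_zero [Fintype V(G)] (h : IsRootedAt (Prod.snd ∘ a) r)
    (ha : ∏ v, arrowWeight G w v (a v) ≠ 0) : IsArborescence G a r where
  isLink v _ := by
    by_contra hv
    exact ha (Finset.prod_eq_zero (Finset.mem_univ v) (if_neg hv))
  isRootedAt := h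

variable [DecidableEq V(G)]

lemma arrowEdges_update {V E : Type*} [DecidableEq V] (a : V → E × V) (r : V) (s : E × V) :
    arrowEdges (update a r s) r = arrowEdges a r :=
  Set.image_congr fun _ hv => by rw [update_of_ne hv]

lemma IsArborescence.update (h : IsArborescence G a r) (s : E(G) × V(G)) :
    IsArborescence G (update a r s) r where
  isLink v hv := by
    rw [update_of_ne hv]
    exact h.isLink v hv
  isRootedAt := by
    rw [comp_update, isRootedAt_update_iff]
    exact h.isRootedAt

lemma rootedSum_arrowWeight [Fintype V(G)] [Fintype E(G)] [Nonempty E(G)]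
    (hw : ∀ e ∈ E(G), 0 < w e) (r : V(G)) (g : Set β → ℝ≥0∞) :
    rootedSum (arrowWeight G w) r (fun a => g (Subtype.val '' arrowEdges a r)) =
      ENNReal.ofReal (G.weightedDegree w r) *
        ∑ t ∈ spanningTrees G, ENNReal.ofReal (treeWeight w t) * g t := by
  classical
  have : Nonempty V(G) := ⟨r⟩
  choose! b hb hbt using fun (t : Set β) (ht : t ∈ spanningTrees G) =>
    exists_isArborescence_of_isSpanningTree (mem_spanningTrees.1 ht) r
  rw [← sum_arrowWeight hw, Finset.sum_mul_sum, ← Finset.sum_product', rootedSum]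
  symm
  refine Finset.sum_of_injOn (fun q => Function.update (b q.2) r q.1) ?_ (by simp) ?_ ?_
  · rintro ⟨s, t⟩ hst ⟨s', t'⟩ hst' heq
    simp only [Finset.coe_product, Finset.coe_univ, Set.mem_prod, Set.mem_univ, true_and,
      Finset.mem_coe] at hst hst' heq
    have hs : s = s' := by simpa only [update_self] using congrFun heq r
    have ht := congrArg (fun a => (Subtype.val '' arrowEdges a r : Set β)) heq
    simp only [arrowEdges_update, hbt t hst, hbt t' hst'] at ht
    rw [hs, ht]
  · intro a _ ha
    by_contra hne
    obtain ⟨hroot, hne⟩ := ite_ne_right_iff.1 hne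
    have harb := isArborescence_of_prod_arrowWeight_ne_zero hroot (left_ne_zero_of_mul hne)
    have ht := mem_spanningTrees.2 harb.isSpanningTree
    have heq := (hb _ ht).eq_of_arrowEdges_eq harb
      (Subtype.val_injective.image_injective (hbt _ ht))
    refine ha ⟨(a r, Subtype.val '' arrowEdges a r), by simpa using ht, ?_⟩
    exact update_eq_iff.2 ⟨rfl, heq⟩
  · rintro ⟨s, t⟩ hst
    have ht : t ∈ spanningTrees G := (Finset.mem_product.1 hst).2
    have harb := (hb t ht).update s
    rw [if_pos harb.isRootedAt, harb.prod_arrowWeight hw, update_self, arrowEdges_update, hbt t ht,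
      mul_assoc]

end ArborescenceSum

lemma sum_stepProb_mul_rootedSum_update_div [Fintype V(G)] [DecidableEq V(G)] [Fintype E(G)]
    [Nonempty E(G)] (hG : G.Connected) (hw : ∀ e ∈ E(G), 0 < w e) (v : V(G))
    (φ : (V(G) → E(G) × V(G)) → ℝ≥0∞) :
    ∑ s : E(G) × V(G), ENNReal.ofReal (G.stepProb w v s.1 s.2) *
      (rootedSum (arrowWeight G w) s.2 (fun a => φ (update a s.2 (s.1, v))) /
        ENNReal.ofReal (G.weightedDegree w s.2)) =
      rootedSum (arrowWeight G w) v φ / ENNReal.ofReal (G.weightedDegree w v) := by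
  have h₀ : ∀ z, ∑ s, arrowWeight G w z s ≠ 0 := fun z => by
    rw [sum_arrowWeight hw]
    exact (ENNReal.ofReal_pos.2 (weightedDegree_pos_of_connected hG hw z.2)).ne'
  have h_top : ∀ z, ∑ s, arrowWeight G w z s ≠ ⊤ := fun z => by
    rw [sum_arrowWeight hw]
    exact ENNReal.ofReal_ne_top
  rw [← sum_mul_rootedSum_update_div _ h₀ h_top, div_eq_mul_inv, Finset.sum_mul]
  refine Finset.sum_congr rfl fun s _ => ?_
  rw [ofReal_stepProb hw, arrowWeight_comm s.2 v, sum_arrowWeight hw, div_eq_mul_inv,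
    mul_right_comm]

end Weights

section History

variable {V E Ω γ : Type*} {X : ℕ → Ω → V} {Y : ℕ → Ω → E} {n : ℕ}

/-- The positions up to time `n` and the edges travelled up to then. A function of `ω` depends only
on the walk up to time `n` exactly if it factors through `history X Y n`. -/
def history (X : ℕ → Ω → V) (Y : ℕ → Ω → E) (n : ℕ) (ω : Ω) : (Fin (n + 1) → V) × (Fin n → E) :=
  (fun i => X i ω, fun i => Y i ω)

lemma history_eq_iff {ω ω' : Ω} :
    history X Y n ω = history X Y n ω' ↔
      (∀ i ≤ n, X i ω = X i ω') ∧ ∀ i < n, Y i ω = Y i ω' := by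
  simp only [history, Prod.mk.injEq, funext_iff, Fin.forall_iff, Nat.lt_succ_iff]

end History

section WalkLaw

lemma lintegral_comp_eq_tsum {Ω κ : Type*} [MeasurableSpace Ω] [Countable κ] {P : Measure Ω}
    {L : Ω → κ} (hL : ∀ k, MeasurableSet (L ⁻¹' {k})) (g : κ → ℝ≥0∞) :
    ∫⁻ ω, g (L ω) ∂P = ∑' k, g k * P (L ⁻¹' {k}) := by
  let _ : MeasurableSpace κ := ⊤
  have hmeas : Measurable L := measurable_to_countable' hL
  rw [← lintegral_map measurable_from_top hmeas, lintegral_countable']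
  exact tsum_congr fun k => by rw [Measure.map_apply hmeas (measurableSet_singleton k)]

variable {α β : Type*} {G : Graph α β} {w : β → ℝ} {x : V(G)} {Ω : Type*} [MeasurableSpace Ω]
  {P : Measure Ω} {X : ℕ → Ω → V(G)} {Y : ℕ → Ω → E(G)} {n : ℕ}

lemma measurableSet_history (h : G.IsWeightedRandomWalk w x P X Y)
    (k : (Fin (n + 1) → V(G)) × (Fin n → E(G))) : MeasurableSet (history X Y n ⁻¹' {k}) := by
  have hinter : history X Y n ⁻¹' {k} =
      (⋂ i : Fin (n + 1), {ω | X i ω = k.1 i}) ∩ ⋂ i : Fin n, {ω | Y i ω = k.2 i} := by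
    ext ω
    simp [history, Prod.ext_iff, funext_iff]
  rw [hinter]
  exact (MeasurableSet.iInter fun i => h.measurableSet_position _ _).inter
    (MeasurableSet.iInter fun i => h.measurableSet_edge _ _)

lemma measure_marginal_succ (h : G.IsWeightedRandomWalk w x P X Y) (v : ℕ → V(G))
    (e : ℕ → E(G)) :
    P {ω | (∀ i ≤ n + 1, X i ω = v i) ∧ ∀ i < n + 1, Y i ω = e i} =
      P {ω | (∀ i ≤ n, X i ω = v i) ∧ ∀ i < n, Y i ω = e i} *
        ENNReal.ofReal (G.stepProb w (v n) (e n) (v (n + 1))) := by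
  rw [h.marginal, h.marginal, Finset.prod_range_succ, ite_mul, zero_mul]

lemma measure_history_step (h : G.IsWeightedRandomWalk w x P X Y)
    (k : (Fin (n + 1) → V(G)) × (Fin n → E(G))) (s : E(G) × V(G)) :
    P ((fun ω => (history X Y n ω, Y n ω, X (n + 1) ω)) ⁻¹' {(k, s)}) =
      P (history X Y n ⁻¹' {k}) *
        ENNReal.ofReal (G.stepProb w (k.1 (Fin.last n)) s.1 s.2) := by
  let v : ℕ → V(G) := fun i => if hi : i < n + 1 then k.1 ⟨i, hi⟩ else s.2
  let e : ℕ → E(G) := fun i => if hi : i < n then k.2 ⟨i, hi⟩ else s.1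
  have hv : ∀ i, (hi : i < n + 1) → v i = k.1 ⟨i, hi⟩ := fun i hi => dif_pos hi
  have he : ∀ i, (hi : i < n) → e i = k.2 ⟨i, hi⟩ := fun i hi => dif_pos hi
  have hvn : v n = k.1 (Fin.last n) := dif_pos n.lt_succ_self
  have hvs : v (n + 1) = s.2 := dif_neg (lt_irrefl _)
  have hes : e n = s.1 := dif_neg (lt_irrefl _)
  have hiff : ∀ ω, history X Y n ω = k ↔ (∀ i ≤ n, X i ω = v i) ∧ ∀ i < n, Y i ω = e i := by
    intro ω
    simp only [history, Prod.ext_iff, funext_iff, Fin.forall_iff, Nat.lt_succ_iff]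
    exact and_congr (forall₂_congr fun i hi => by rw [hv i (Nat.lt_succ_of_le hi)])
      (forall₂_congr fun i hi => by rw [he i hi])
  have hsucc := measure_marginal_succ (n := n) h v e
  rw [hvs, hes, hvn] at hsucc
  convert hsucc using 2
  · ext ω
    simp only [Set.mem_preimage, Set.mem_singleton_iff, Prod.ext_iff (y := (k, s)),
      Prod.ext_iff (y := s), hiff, Set.mem_ofPred_eq, ← hvs, ← hes, Nat.lt_succ_iff_lt_or_eq,
      Nat.le_succ_iff, or_imp, forall_and, forall_eq]
    tauto
  · exact congrArg P (Set.ext hiff)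

lemma ae_position_zero [IsProbabilityMeasure P] (h : G.IsWeightedRandomWalk w x P X Y) :
    ∀ᵐ ω ∂P, X 0 ω = x := by
  obtain ⟨ω₀⟩ := nonempty_of_isProbabilityMeasure P
  have hstart := h.marginal 0 (fun _ => x) (fun _ => Y 0 ω₀)
  simp only [Nat.le_zero, forall_eq, not_lt_zero, IsEmpty.forall_iff, implies_true, and_true,
    if_true, Finset.range_zero, Finset.prod_empty] at hstart
  exact (mem_ae_iff_prob_eq_one (h.measurableSet_position 0 x)).2 hstart

variable [Countable V(G)] [Countable E(G)]

lemma measurable_of_factorsThrough_history {γ : Type*} [MeasurableSpace γ]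
    (h : G.IsWeightedRandomWalk w x P X Y) {f : Ω → γ} (hf : FactorsThrough f (history X Y n)) :
    Measurable f := by
  intro S _
  have hfibres : f ⁻¹' S = ⋃ k ∈ history X Y n '' (f ⁻¹' S), history X Y n ⁻¹' {k} := by
    rw [Set.biUnion_preimage_singleton]
    refine (Set.subset_preimage_image _ _).antisymm ?_
    rintro ω ⟨ω', hω', heq⟩
    rwa [Set.mem_preimage, ← hf heq]
  rw [hfibres]
  exact MeasurableSet.biUnion (Set.to_countable _) fun k _ => measurableSet_history h k

lemma measurableSet_of_factorsThrough_history (h : G.IsWeightedRandomWalk w x P X Y)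
    {p : Ω → Prop} (hp : FactorsThrough p (history X Y n)) : MeasurableSet {ω | p ω} :=
  measurableSet_setOfPred.2 (measurable_of_factorsThrough_history h hp)

lemma lintegral_markov (h : G.IsWeightedRandomWalk w x P X Y)
    {F : E(G) × V(G) → Ω → ℝ≥0∞} (hF : ∀ s, FactorsThrough (F s) (history X Y n)) :
    ∫⁻ ω, F (Y n ω, X (n + 1) ω) ω ∂P =
      ∫⁻ ω, ∑' s : E(G) × V(G), ENNReal.ofReal (G.stepProb w (X n ω) s.1 s.2) * F s ω ∂P := by
  choose g hg using fun s => (factorsThrough_iff (F s)).1 (hF s)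
  obtain rfl : (fun s => g s ∘ history X Y n) = F := funext fun s => (hg s).symm
  have hstep : ∀ q : ((Fin (n + 1) → V(G)) × (Fin n → E(G))) × (E(G) × V(G)),
      MeasurableSet ((fun ω => (history X Y n ω, Y n ω, X (n + 1) ω)) ⁻¹' {q}) := by
    rintro ⟨k, s⟩
    convert (measurableSet_history h k).inter
      ((h.measurableSet_edge n s.1).inter (h.measurableSet_position (n + 1) s.2)) using 1
    ext ω
    simp [Prod.ext_iff]
  calc ∫⁻ ω, g (Y n ω, X (n + 1) ω) (history X Y n ω) ∂P
      = ∑' k, ∑' s, g s k * P ((fun ω => (history X Y n ω, Y n ω, X (n + 1) ω)) ⁻¹' {(k, s)}) := by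
        rw [lintegral_comp_eq_tsum hstep fun q => g q.2 q.1, ENNReal.tsum_prod']
    _ = ∑' k, (∑' s : E(G) × V(G), ENNReal.ofReal (G.stepProb w (k.1 (Fin.last n)) s.1 s.2) *
          g s k) * P (history X Y n ⁻¹' {k}) := by
        simp only [measure_history_step h, ← ENNReal.tsum_mul_right]
        exact tsum_congr fun k => tsum_congr fun s => by ring
    _ = _ := (lintegral_comp_eq_tsum (measurableSet_history h) _).symm

lemma measure_and_step (h : G.IsWeightedRandomWalk w x P X Y) {p : Ω → Prop}
    (hp : FactorsThrough p (history X Y n)) {u : V(G)} (hu : ∀ ω, p ω → X n ω = u)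
    (s : E(G) × V(G)) :
    P {ω | p ω ∧ Y n ω = s.1 ∧ X (n + 1) ω = s.2} =
      P {ω | p ω} * ENNReal.ofReal (G.stepProb w u s.1 s.2) := by
  classical
  have hmeas : MeasurableSet {ω | p ω} := measurableSet_of_factorsThrough_history h hp
  have hmarkov := lintegral_markov h (n := n)
    (F := fun s' ω => if p ω ∧ s' = s then 1 else 0) fun s' ω ω' hω => by simp only [hp hω]
  have hsum : ∀ ω, ∑' s' : E(G) × V(G), ENNReal.ofReal (G.stepProb w (X n ω) s'.1 s'.2) *
      (if p ω ∧ s' = s then 1 else 0) =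
      {ω | p ω}.indicator (fun _ => ENNReal.ofReal (G.stepProb w u s.1 s.2)) ω := by
    intro ω
    rw [tsum_eq_single s fun s' hs' => by simp [hs']]
    by_cases hω : p ω
    · simp [hω, hu ω hω]
    · simp [hω]
  have hset : ∀ ω, (if p ω ∧ (Y n ω, X (n + 1) ω) = s then (1 : ℝ≥0∞) else 0) =
      {ω | p ω ∧ Y n ω = s.1 ∧ X (n + 1) ω = s.2}.indicator 1 ω := fun ω => by
    simp only [Set.indicator_apply, Set.mem_ofPred_eq, Prod.ext_iff, Pi.one_apply]
  simp only [hsum, hset] at hmarkov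
  rwa [lintegral_indicator_const hmeas, lintegral_indicator_one, mul_comm] at hmarkov
  exact hmeas.inter ((h.measurableSet_edge n s.1).inter (h.measurableSet_position (n + 1) s.2))

lemma ae_isLink (h : G.IsWeightedRandomWalk w x P X Y) :
    ∀ᵐ ω ∂P, ∀ n, G.IsLink (Y n ω) (X n ω) (X (n + 1) ω) := by
  have hnull : ∀ n (u : V(G)) (s : E(G) × V(G)), ¬ G.IsLink s.1 u s.2 →
      ∀ᵐ ω ∂P, ¬ (X n ω = u ∧ Y n ω = s.1 ∧ X (n + 1) ω = s.2) := by
    intro n u s hs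
    rw [ae_iff]
    simp only [not_not]
    rw [measure_and_step h (p := fun ω => X n ω = u)
      (fun ω ω' hω => congrArg (· = u) ((history_eq_iff.1 hω).1 n le_rfl)) (fun _ => id) s,
      stepProb, if_neg hs, ENNReal.ofReal_zero, mul_zero]
  simp only [← ae_all_iff] at hnull
  filter_upwards [hnull] with ω hω n
  exact by_contra fun hlink => hω n _ (Y n ω, X (n + 1) ω) hlink ⟨rfl, rfl, rfl⟩

end WalkLaw

section Recurrence

variable {α β : Type*} {G : Graph α β} {w : β → ℝ} {x : V(G)} {Ω : Type*} [MeasurableSpace Ω]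
  {P : Measure Ω} {X : ℕ → Ω → V(G)} {Y : ℕ → Ω → E(G)}

lemma tsum_measure_hit_le_one [IsProbabilityMeasure P] (h : G.IsWeightedRandomWalk w x P X Y)
    (v : V(G)) : ∑' n, P {ω | X (n + 1) ω = v ∧ ∀ i ≤ n, X i ω ≠ v} ≤ 1 := by
  rw [← measure_univ (μ := P)]
  refine tsum_measure_le_measure_univ (fun n => ?_) fun m n hmn => ?_
  · simp only [Set.ofPred_and, Set.ofPred_forall]
    exact ((h.measurableSet_position _ v).inter (MeasurableSet.iInter fun i =>
      MeasurableSet.iInter fun _ => (h.measurableSet_position i v).compl)).nullMeasurableSet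
  · refine (Set.disjoint_left.2 fun ω hm hn => ?_).aedisjoint
    rcases lt_or_gt_of_ne hmn with hlt | hlt
    · exact hn.2 (m + 1) hlt hm.1
    · exact hm.2 (n + 1) hlt hn.1

lemma measure_avoid_mul_stepProb_le [Countable V(G)] [Countable E(G)]
    (h : G.IsWeightedRandomWalk w x P X Y) (v u : V(G)) (s : E(G) × V(G)) (n : ℕ) :
    P {ω | X n ω = u ∧ ∀ i ≤ n, X i ω ≠ v} * ENNReal.ofReal (G.stepProb w u s.1 s.2) ≤
      P {ω | X (n + 1) ω = s.2 ∧ ∀ i ≤ n + 1, X i ω ≠ v} +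
        P {ω | X (n + 1) ω = v ∧ ∀ i ≤ n, X i ω ≠ v} := by
  have hhistory : FactorsThrough (fun ω => X n ω = u ∧ ∀ i ≤ n, X i ω ≠ v) (history X Y n) := by
    intro ω ω' hω
    have hX := (history_eq_iff.1 hω).1
    simp only [hX n le_rfl]
    exact congrArg _ (propext (forall₂_congr fun i hi => by rw [hX i hi]))
  rw [← measure_and_step h hhistory (fun ω hω => hω.1)]
  refine (measure_mono ?_).trans (measure_union_le _ _)
  rintro ω ⟨⟨-, havoid⟩, -, hnext⟩
  by_cases hv : X (n + 1) ω = v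
  · exact Or.inr ⟨hv, havoid⟩
  · refine Or.inl ⟨hnext, fun i hi => ?_⟩
    rcases Nat.le_succ_iff.1 hi with hi | rfl
    · exact havoid i hi
    · exact hv

lemma tsum_measure_avoid_ne_top [Countable V(G)] [Finite E(G)] [IsProbabilityMeasure P]
    (h : G.IsWeightedRandomWalk w x P X Y) (hG : G.Connected) (hw : ∀ e ∈ E(G), 0 < w e)
    (v u : V(G)) : ∑' n, P {ω | X n ω = u ∧ ∀ i ≤ n, X i ω ≠ v} ≠ ⊤ := by
  induction reflTransGen_adj_of_connected hG u v using
    Relation.ReflTransGen.head_induction_on with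
  | refl =>
    have hempty : ∀ n, {ω | X n ω = v ∧ ∀ i ≤ n, X i ω ≠ v} = ∅ := fun n =>
      Set.eq_empty_of_forall_notMem fun ω hω => hω.2 n le_rfl hω.1
    simp [hempty]
  | @head u u' hadj _ ih =>
    obtain ⟨e, he⟩ := hadj
    have hstep : ENNReal.ofReal (G.stepProb w u e u') ≠ 0 :=
      (ENNReal.ofReal_pos.2 (stepProb_pos hw he)).ne'
    have hsucc : ∑' n, P {ω | X (n + 1) ω = u' ∧ ∀ i ≤ n + 1, X i ω ≠ v} ≠ ⊤ :=
      ne_top_of_le_ne_top ih (ENNReal.tsum_comp_le_tsum_of_injective (add_left_injective 1) _)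
    have hhit := ne_top_of_le_ne_top ENNReal.one_ne_top (tsum_measure_hit_le_one h v)
    have hle := ENNReal.tsum_le_tsum
      (measure_avoid_mul_stepProb_le h v u (⟨e, he.edge_mem⟩, u'))
    rw [ENNReal.tsum_mul_right, ENNReal.tsum_add] at hle
    exact (ENNReal.lt_top_of_mul_ne_top_left
      (ne_top_of_le_ne_top (ENNReal.add_ne_top.2 ⟨hsucc, hhit⟩) hle) hstep).ne

lemma ae_exists_position_eq [Finite V(G)] [Finite E(G)] [IsProbabilityMeasure P]
    (h : G.IsWeightedRandomWalk w x P X Y) (hG : G.Connected) (hw : ∀ e ∈ E(G), 0 < w e) :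
    ∀ᵐ ω ∂P, ∀ v, ∃ n, X n ω = v := by
  have := Fintype.ofFinite V(G)
  rw [ae_all_iff]
  intro v
  by_contra hpos
  rw [ae_iff] at hpos
  push Not at hpos
  refine ENNReal.sum_ne_top.2
    (fun u (_ : u ∈ Finset.univ) => tsum_measure_avoid_ne_top h hG hw v u) ?_
  rw [← Summable.tsum_finsetSum fun _ _ => ENNReal.summable]
  refine top_unique ((ENNReal.tsum_const_eq_top_of_ne_zero (α := ℕ) hpos).ge.trans ?_)
  refine ENNReal.tsum_le_tsum fun n => (measure_mono ?_).trans (measure_biUnion_finset_le _ _)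
  intro ω hω
  simpa using fun i _ => hω i

end Recurrence

section PrependWalk

variable {V E : Type*}

lemma mem_groundskeeperTree {y : ℕ → V} {f : ℕ → E} {e : E} :
    e ∈ groundskeeperTree y f ↔ ∃ k, f k = e ∧ ∀ j ≤ k, y j ≠ y (k + 1) := by
  simp only [groundskeeperTree, groundskeeper, Set.mem_image, Set.mem_ofPred_eq]
  constructor
  · rintro ⟨_, ⟨k, rfl, hk⟩, rfl⟩
    exact ⟨k, rfl, hk⟩
  · rintro ⟨k, rfl, hk⟩
    exact ⟨_, ⟨k, rfl, hk⟩, rfl⟩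

lemma groundskeeperTree_comp {V' E' : Type*} {i : V → V'} (hi : Injective i) (j : E → E')
    (y : ℕ → V) (f : ℕ → E) :
    groundskeeperTree (i ∘ y) (j ∘ f) = j '' groundskeeperTree y f := by
  ext e
  simp only [mem_groundskeeperTree, Set.mem_image, comp_apply, hi.ne_iff]
  constructor
  · rintro ⟨k, rfl, hk⟩
    exact ⟨f k, ⟨k, rfl, hk⟩, rfl⟩
  · rintro ⟨_, ⟨k, rfl, hk⟩, rfl⟩
    exact ⟨k, rfl, hk⟩

lemma exists_forall_exists_le_of_forall_exists [Finite V] {y : ℕ → V} (h : ∀ v, ∃ i, y i = v) :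
    ∃ n, ∀ v, ∃ i ≤ n, y i = v := by
  choose i hi using h
  obtain ⟨n, hn⟩ := (Set.finite_range i).bddAbove
  exact ⟨n, fun v => ⟨i v, hn ⟨v, rfl⟩, hi v⟩⟩

lemma exists_first_entrance {y : ℕ → V} {n : ℕ} (h : ∀ v, ∃ i ≤ n, y i = v) {v : V}
    (hv : v ≠ y 0) : ∃ k < n, y (k + 1) = v ∧ ∀ j ≤ k, y j ≠ v := by
  classical
  obtain ⟨hle, hfind⟩ := Nat.find_spec (h v)
  obtain ⟨k, hk⟩ := Nat.exists_eq_succ_of_ne_zero fun h₀ : Nat.find (h v) = 0 =>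
    hv (by rw [← hfind, h₀])
  rw [hk] at hle hfind
  exact ⟨k, hle, hfind, fun j hj hjv =>
    Nat.find_min (h v) (hk ▸ Nat.lt_succ_of_le hj) ⟨by omega, hjv⟩⟩

variable [DecidableEq V]

/-- The arrows `a`, overwritten at every vertex that the walk `y 0, …, y n` enters with the arrow
back along the edge by which it is first entered (not counting the start of the walk as an
entrance). -/
def prependWalk (y : ℕ → V) (f : ℕ → E) : ℕ → (V → E × V) → V → E × V
  | 0, a => a
  | n + 1, a => prependWalk y f n (update a (y (n + 1)) (f n, y n))

variable {y : ℕ → V} {f : ℕ → E} {n : ℕ}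

lemma prependWalk_of_forall_ne {v : V} (h : ∀ j < n, y (j + 1) ≠ v) (a : V → E × V) :
    prependWalk y f n a v = a v := by
  induction n generalizing a with
  | zero => rfl
  | succ n ih =>
    rw [prependWalk, ih fun j hj => h j (by omega), update_of_ne (h n n.lt_succ_self).symm]

lemma prependWalk_of_first_entrance {k : ℕ} (hk : k < n) (h : ∀ j ≤ k, y j ≠ y (k + 1))
    (a : V → E × V) : prependWalk y f n a (y (k + 1)) = (f k, y k) := by
  induction n generalizing a with
  | zero => omega
  | succ n ih =>
    rcases Nat.lt_succ_iff_lt_or_eq.1 hk with hk | rfl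
    · exact ih hk _
    · rw [prependWalk, prependWalk_of_forall_ne fun j hj => h (j + 1) hj, update_self]

lemma prependWalk_congr {y' : ℕ → V} {f' : ℕ → E} (hy : ∀ i ≤ n, y i = y' i)
    (hf : ∀ i < n, f i = f' i) : prependWalk y f n = prependWalk y' f' n := by
  induction n with
  | zero => rfl
  | succ n ih =>
    funext a
    rw [prependWalk, prependWalk, ih (fun i hi => hy i (by omega)) (fun i hi => hf i (by omega)),
      hy n (by omega), hy (n + 1) le_rfl, hf n (by omega)]

lemma arrowEdges_prependWalk (h : ∀ v, ∃ i ≤ n, y i = v) (a : V → E × V) :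
    arrowEdges (prependWalk y f n a) (y 0) = groundskeeperTree y f := by
  ext e
  rw [mem_groundskeeperTree]
  constructor
  · rintro ⟨v, hv, rfl⟩
    obtain ⟨k, hk, rfl, hfirst⟩ := exists_first_entrance h hv
    exact ⟨k, (congrArg Prod.fst (prependWalk_of_first_entrance hk hfirst a)).symm, hfirst⟩
  · rintro ⟨k, rfl, hfirst⟩
    obtain ⟨i, hi, hik⟩ := h (y (k + 1))
    have hk : k < n := by
      by_contra hk
      exact hfirst i (by omega) hik
    exact ⟨y (k + 1), (hfirst 0 k.zero_le).symm,
      congrArg Prod.fst (prependWalk_of_first_entrance hk hfirst a)⟩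

end PrependWalk

lemma isArborescence_prependWalk {α β : Type*} {G : Graph α β} [DecidableEq V(G)] {y : ℕ → V(G)}
    {f : ℕ → E(G)} {n : ℕ} (h : ∀ v, ∃ i ≤ n, y i = v)
    (hlink : ∀ k, G.IsLink (f k) (y k) (y (k + 1))) (a : V(G) → E(G) × V(G)) :
    IsArborescence G (prependWalk y f n a) (y 0) where
  isLink v hv := by
    obtain ⟨k, hk, rfl, hfirst⟩ := exists_first_entrance h hv
    rw [prependWalk_of_first_entrance hk hfirst]
    exact (hlink k).symm
  isRootedAt := by
    have hhit : ∀ v, ∃ i, y i = v := fun v => (h v).imp fun i hi => hi.2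
    refine isRootedAt_iff_exists_rank.2 ⟨fun v => Nat.find (hhit v), fun v hv => ?_⟩
    obtain ⟨k, hk, rfl, hfirst⟩ := exists_first_entrance h hv
    rw [comp_apply, prependWalk_of_first_entrance hk hfirst]
    exact (Nat.find_min' (hhit (y k)) rfl).trans_lt
      ((Nat.lt_find_iff (hhit (y (k + 1))) k).2 hfirst)

section GroundskeeperTree

variable {α β : Type*} {G : Graph α β} {w : β → ℝ} {x : V(G)} {Ω : Type*} [MeasurableSpace Ω]
  {P : Measure Ω} {X : ℕ → Ω → V(G)} {Y : ℕ → Ω → E(G)}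

lemma measurableSet_groundskeeperTree_eq [Countable V(G)] [Countable E(G)]
    (h : G.IsWeightedRandomWalk w x P X Y) (s : Set E(G)) :
    MeasurableSet {ω | groundskeeperTree (X · ω) (Y · ω) = s} := by
  have hmem : ∀ e, Measurable fun ω => e ∈ groundskeeperTree (X · ω) (Y · ω) := by
    intro e
    simp only [mem_groundskeeperTree]
    refine Measurable.exists fun k =>
      measurable_of_factorsThrough_history (n := k + 1) h fun ω ω' hω => ?_
    obtain ⟨hX, hY⟩ := history_eq_iff.1 hω
    simp only [hY k k.lt_succ_self, hX (k + 1) le_rfl]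
    exact congrArg _ (propext (forall₂_congr fun j hj => by rw [hX j (by omega)]))
  simp only [Set.ext_iff, Set.ofPred_forall]
  exact MeasurableSet.iInter fun e => measurableSet_setOfPred.2 ((hmem e).iff measurable_const)

lemma ae_isSpanningTree [Finite V(G)] [Finite E(G)] [IsProbabilityMeasure P]
    (h : G.IsWeightedRandomWalk w x P X Y) (hG : G.Connected) (hw : ∀ e ∈ E(G), 0 < w e) :
    ∀ᵐ ω ∂P, G.IsSpanningTree (Subtype.val '' groundskeeperTree (X · ω) (Y · ω)) := by
  classical
  filter_upwards [ae_isLink h, ae_exists_position_eq h hG hw] with ω hlink hcover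
  obtain ⟨n, hn⟩ := exists_forall_exists_le_of_forall_exists hcover
  rw [← arrowEdges_prependWalk hn fun _ => (Y 0 ω, X 0 ω)]
  exact (isArborescence_prependWalk hn hlink _).isSpanningTree

end GroundskeeperTree

section Martingale

variable {α β : Type*} {G : Graph α β} {w : β → ℝ} [Fintype V(G)] [DecidableEq V(G)]
  [Fintype E(G)]

variable (w) in
/-- The weighted sum of `φ` over the arborescences with root `y n` with the walk `y 0, …, y n`
prepended. The division undoes the sum over the free arrow at the root. -/
def prependedSum (φ : (V(G) → E(G) × V(G)) → ℝ≥0∞) (y : ℕ → V(G)) (f : ℕ → E(G)) (n : ℕ) :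
    ℝ≥0∞ :=
  rootedSum (arrowWeight G w) (y n) (fun a => φ (prependWalk y f n a)) /
    ENNReal.ofReal (G.weightedDegree w (y n))

lemma prependedSum_congr {φ : (V(G) → E(G) × V(G)) → ℝ≥0∞} {y y' : ℕ → V(G)} {f f' : ℕ → E(G)}
    {n : ℕ} (hy : ∀ i ≤ n, y i = y' i) (hf : ∀ i < n, f i = f' i) :
    prependedSum w φ y f n = prependedSum w φ y' f' n := by
  rw [prependedSum, prependedSum, prependWalk_congr hy hf, hy n le_rfl]

section Values

variable [Nonempty E(G)] {y : ℕ → V(G)} {f : ℕ → E(G)} {n : ℕ}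

lemma rootedSum_arrowWeight_div (hG : G.Connected) (hw : ∀ e ∈ E(G), 0 < w e) (r : V(G))
    (g : Set β → ℝ≥0∞) :
    rootedSum (arrowWeight G w) r (fun a => g (Subtype.val '' arrowEdges a r)) /
      ENNReal.ofReal (G.weightedDegree w r) =
      ∑ t ∈ spanningTrees G, ENNReal.ofReal (treeWeight w t) * g t := by
  rw [rootedSum_arrowWeight hw, mul_comm, ENNReal.mul_div_cancel_right
    (ENNReal.ofReal_pos.2 (weightedDegree_pos_of_connected hG hw r.2)).ne' ENNReal.ofReal_ne_top]

lemma prependedSum_const (hG : G.Connected) (hw : ∀ e ∈ E(G), 0 < w e) (c : ℝ≥0∞) :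
    prependedSum w (fun _ => c) y f n =
      (∑ t ∈ spanningTrees G, ENNReal.ofReal (treeWeight w t)) * c := by
  rw [Finset.sum_mul]
  exact rootedSum_arrowWeight_div hG hw (y n) fun _ => c

lemma prependedSum_of_cover (hG : G.Connected) (hw : ∀ e ∈ E(G), 0 < w e)
    (hn : ∀ v, ∃ i ≤ n, y i = v) (g : Set β → ℝ≥0∞) :
    prependedSum w (fun a => g (Subtype.val '' arrowEdges a (y 0))) y f n =
      (∑ t ∈ spanningTrees G, ENNReal.ofReal (treeWeight w t)) *
        g (Subtype.val '' groundskeeperTree y f) := by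
  rw [← prependedSum_const hG hw (y := y) (f := f) (n := n)]
  simp only [prependedSum, arrowEdges_prependWalk hn]

end Values

lemma prependedSum_mono {φ ψ : (V(G) → E(G) × V(G)) → ℝ≥0∞} (h : ∀ a, φ a ≤ ψ a)
    (y : ℕ → V(G)) (f : ℕ → E(G)) (n : ℕ) :
    prependedSum w φ y f n ≤ prependedSum w ψ y f n :=
  ENNReal.div_le_div_right (rootedSum_mono fun _ => h _) _

variable {x : V(G)} {Ω : Type*} [MeasurableSpace Ω] {P : Measure Ω} {X : ℕ → Ω → V(G)}
  {Y : ℕ → Ω → E(G)}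

lemma measurable_prependedSum (h : G.IsWeightedRandomWalk w x P X Y)
    (φ : (V(G) → E(G) × V(G)) → ℝ≥0∞) (n : ℕ) :
    Measurable fun ω => prependedSum w φ (X · ω) (Y · ω) n :=
  measurable_of_factorsThrough_history h fun _ _ hω =>
    prependedSum_congr (history_eq_iff.1 hω).1 (history_eq_iff.1 hω).2

lemma lintegral_prependedSum_succ [Nonempty E(G)] (h : G.IsWeightedRandomWalk w x P X Y)
    (hG : G.Connected) (hw : ∀ e ∈ E(G), 0 < w e) (φ : (V(G) → E(G) × V(G)) → ℝ≥0∞) (n : ℕ) :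
    ∫⁻ ω, prependedSum w φ (X · ω) (Y · ω) (n + 1) ∂P =
      ∫⁻ ω, prependedSum w φ (X · ω) (Y · ω) n ∂P := by
  let F : E(G) × V(G) → Ω → ℝ≥0∞ := fun s ω =>
    rootedSum (arrowWeight G w) s.2
      (fun a => φ (prependWalk (X · ω) (Y · ω) n (update a s.2 (s.1, X n ω)))) /
      ENNReal.ofReal (G.weightedDegree w s.2)
  have hF : ∀ s, FactorsThrough (F s) (history X Y n) := fun s ω ω' hω => by
    obtain ⟨hX, hY⟩ := history_eq_iff.1 hω
    simp only [F, prependWalk_congr hX hY, hX n le_rfl]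
  have hsucc : ∀ ω, prependedSum w φ (X · ω) (Y · ω) (n + 1) = F (Y n ω, X (n + 1) ω) ω :=
    fun _ => rfl
  simp only [hsucc]
  rw [lintegral_markov h hF]
  refine lintegral_congr fun ω => ?_
  rw [tsum_fintype]
  exact sum_stepProb_mul_rootedSum_update_div hG hw (X n ω) fun a =>
    φ (prependWalk (X · ω) (Y · ω) n a)

lemma lintegral_prependedSum_eq [Nonempty E(G)] [IsProbabilityMeasure P]
    (h : G.IsWeightedRandomWalk w x P X Y) (hG : G.Connected) (hw : ∀ e ∈ E(G), 0 < w e)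
    (g : Set β → ℝ≥0∞) (n : ℕ) :
    ∫⁻ ω, prependedSum w (fun a => g (Subtype.val '' arrowEdges a x)) (X · ω) (Y · ω) n ∂P =
      ∑ t ∈ spanningTrees G, ENNReal.ofReal (treeWeight w t) * g t := by
  induction n with
  | zero =>
    rw [lintegral_congr_ae (g := fun _ =>
      ∑ t ∈ spanningTrees G, ENNReal.ofReal (treeWeight w t) * g t), lintegral_const,
      measure_univ, mul_one]
    filter_upwards [ae_position_zero h] with ω hω
    rw [prependedSum, hω]
    exact rootedSum_arrowWeight_div hG hw x g
  | succ n ih => rw [lintegral_prependedSum_succ h hG hw, ih]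

end Martingale

section Law

variable {α β : Type*} {G : Graph α β} {w : β → ℝ} {x : V(G)} {Ω : Type*} [MeasurableSpace Ω]
  {P : Measure Ω} {X : ℕ → Ω → V(G)} {Y : ℕ → Ω → E(G)} {t : Set β}

lemma measurableSet_coe_groundskeeperTree_eq [Countable V(G)] [Countable E(G)]
    (h : G.IsWeightedRandomWalk w x P X Y) (ht : t ⊆ E(G)) :
    MeasurableSet {ω | Subtype.val '' groundskeeperTree (X · ω) (Y · ω) = t} := by
  lift t to Set E(G) using ht
  simpa only [Subtype.val_injective.image_injective.eq_iff] using
    measurableSet_groundskeeperTree_eq h t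

lemma sum_treeWeight_mul_lintegral_groundskeeperTree [Finite V(G)] [Finite E(G)]
    [IsProbabilityMeasure P] (h : G.IsWeightedRandomWalk w x P X Y) (hG : G.Connected)
    (hw : ∀ e ∈ E(G), 0 < w e) {g : Set β → ℝ≥0∞} {C : ℝ≥0∞} (hC : C ≠ ⊤) (hg : ∀ t, g t ≤ C) :
    (∑ t ∈ spanningTrees G, ENNReal.ofReal (treeWeight w t)) *
      ∫⁻ ω, g (Subtype.val '' groundskeeperTree (X · ω) (Y · ω)) ∂P =
      ∑ t ∈ spanningTrees G, ENNReal.ofReal (treeWeight w t) * g t := by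
  classical
  have := Fintype.ofFinite V(G)
  have := Fintype.ofFinite E(G)
  obtain ⟨ω₀⟩ := nonempty_of_isProbabilityMeasure P
  have : Nonempty E(G) := ⟨Y 0 ω₀⟩
  set Z := ∑ t ∈ spanningTrees G, ENNReal.ofReal (treeWeight w t)
  have hZ : Z ≠ ⊤ := ENNReal.sum_ne_top.2 fun _ _ => ENNReal.ofReal_ne_top
  have hbound : ∀ n ω, prependedSum w (fun a => g (Subtype.val '' arrowEdges a x))
      (X · ω) (Y · ω) n ≤ Z * C := fun n ω =>
    (prependedSum_mono (fun _ => hg _) _ _ n).trans_eq (prependedSum_const hG hw C)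
  have hlim : ∀ᵐ ω ∂P, Filter.Tendsto
      (prependedSum w (fun a => g (Subtype.val '' arrowEdges a x)) (X · ω) (Y · ω)) Filter.atTop
      (nhds (Z * g (Subtype.val '' groundskeeperTree (X · ω) (Y · ω)))) := by
    filter_upwards [ae_position_zero h, ae_exists_position_eq h hG hw] with ω hstart hcover
    obtain ⟨n, hn⟩ := exists_forall_exists_le_of_forall_exists hcover
    refine tendsto_atTop_of_eventually_const (i₀ := n) fun m hm => ?_
    rw [← hstart]
    exact prependedSum_of_cover hG hw (y := (X · ω))
      (fun v => (hn v).imp fun i hi => ⟨hi.1.trans hm, hi.2⟩) g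
  have hintegral := tendsto_lintegral_of_dominated_convergence (fun _ => Z * C)
    (measurable_prependedSum h _) (fun n => ae_of_all P (hbound n))
    (by rw [lintegral_const, measure_univ, mul_one]; exact ENNReal.mul_ne_top hZ hC) hlim
  simp only [lintegral_prependedSum_eq h hG hw] at hintegral
  rw [← lintegral_const_mul' _ _ hZ]
  exact tendsto_nhds_unique hintegral tendsto_const_nhds

lemma measure_groundskeeperTree_eq [Finite V(G)] [Finite E(G)] [IsProbabilityMeasure P]
    (h : G.IsWeightedRandomWalk w x P X Y) (hG : G.Connected) (hw : ∀ e ∈ E(G), 0 < w e)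
    (ht : G.IsSpanningTree t) :
    P {ω | Subtype.val '' groundskeeperTree (X · ω) (Y · ω) = t} =
      ENNReal.ofReal (G.weightSelectedProb w t) := by
  have htrees : t ∈ spanningTrees G := mem_spanningTrees.2 ht
  have hpos : ∀ u ∈ spanningTrees G, 0 < treeWeight w u := fun u hu =>
    treeWeight_pos hw (mem_spanningTrees.1 hu).1
  have hsum : 0 < ∑ u ∈ spanningTrees G, treeWeight w u := Finset.sum_pos hpos ⟨t, htrees⟩
  have hindicator : ∀ ω, ({t} : Set (Set β)).indicator 1
      (Subtype.val '' groundskeeperTree (X · ω) (Y · ω)) =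
      {ω | Subtype.val '' groundskeeperTree (X · ω) (Y · ω) = t}.indicator (1 : Ω → ℝ≥0∞) ω :=
    fun _ => rfl
  have hsingle : ∑ u ∈ spanningTrees G, ENNReal.ofReal (treeWeight w u) *
      ({t} : Set (Set β)).indicator 1 u = ENNReal.ofReal (treeWeight w t) := by
    rw [Finset.sum_eq_single t (fun u _ hu => by simp [hu]) (absurd htrees),
      Set.indicator_of_mem (Set.mem_singleton t), Pi.one_apply, mul_one]
  have hprob := sum_treeWeight_mul_lintegral_groundskeeperTree h hG hw
    (g := ({t} : Set (Set β)).indicator 1) ENNReal.one_ne_top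
    (Set.indicator_le_self' fun _ _ => zero_le)
  simp only [hindicator,
    lintegral_indicator_one (measurableSet_coe_groundskeeperTree_eq h ht.1)] at hprob
  rw [hsingle, ← ENNReal.ofReal_sum_of_nonneg fun u hu => (hpos u hu).le, mul_comm] at hprob
  rwa [weightSelectedProb_eq_div, ENNReal.ofReal_div_of_pos hsum,
    ENNReal.eq_div_iff (ENNReal.ofReal_pos.2 hsum).ne' ENNReal.ofReal_ne_top, mul_comm]

end Law

end AldousBroder

end

theorem mainTheorem3 {α β : Type*} (G : Graph α β) (hV : V(G).Finite) (hE : E(G).Finite)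
    (hG : G.Connected) (w : β → ℝ) (hw : ∀ e ∈ E(G), 0 < w e) (x : V(G))
    {Ω : Type*} [MeasurableSpace Ω] (P : MeasureTheory.Measure Ω)
    [MeasureTheory.IsProbabilityMeasure P]
    (X : ℕ → Ω → V(G)) (Y : ℕ → Ω → E(G)) (hXY : G.IsWeightedRandomWalk w x P X Y)
    (T : Ω → Set β)
    (hT : ∀ ω, T ω = Graph.groundskeeperTree (fun n => (X n ω : α)) (fun n => (Y n ω : β))) :
    (∀ᵐ ω ∂P, G.IsSpanningTree (T ω)) ∧
    (∀ t : Set β, G.IsSpanningTree t →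
      MeasurableSet {ω | T ω = t} ∧
      P {ω | T ω = t} = ENNReal.ofReal (G.weightSelectedProb w t)) ∧
    ((∀ e ∈ E(G), w e = 1) → ∀ t : Set β, G.IsSpanningTree t →
      P {ω | T ω = t} = 1 / ({u : Set β | G.IsSpanningTree u}.ncard : ENNReal)) := by
  have := hV.to_subtype
  have := hE.to_subtype
  have hT' : ∀ ω, T ω = Subtype.val '' Graph.groundskeeperTree (X · ω) (Y · ω) := fun ω =>
    (hT ω).trans (AldousBroder.groundskeeperTree_comp Subtype.val_injective Subtype.val _ _)
  simp only [hT']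
  refine ⟨AldousBroder.ae_isSpanningTree hXY hG hw, fun t ht =>
    ⟨AldousBroder.measurableSet_coe_groundskeeperTree_eq hXY ht.1,
      AldousBroder.measure_groundskeeperTree_eq hXY hG hw ht⟩, fun hw₁ t ht => ?_⟩
  rw [AldousBroder.measure_groundskeeperTree_eq hXY hG hw ht,
    AldousBroder.ofReal_weightSelectedProb_of_eq_one hw₁ ht]
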